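/- Let $n\ge 1$, let $\gamma_0<\gamma_1<\dots<\gamma_{n-1}$ be real numbers and write $[n]=\{0,\dots,n-1\}$. Let the outcome $Y$ and the potential outcomes $Y^{(d,z)}$ ($d,z\in\{0,1\}$) take values in $\{\gamma_0,\dots,\gamma_{n-1}\}$, and let the treatment $D$ and the instrument $Z$ take values in $\{0,1\}$, all on one probability space; the joint law of these variables is called a full data law, and $\mathcal P=\mathcal L(Y,D,Z)$ is its observed law. Consider the model given by 1. exclusion: $Y^{(d,0)}=Y^{(d,1)}$ almost surely for $d\in\{0,1\}$; the common value is denoted $Y^{(d)}$; 2. joint independence: $Z$ is independent of the pair $(Y^{(0)},Y^{(1)})$; 3. outcome consistency: $Y=(1-D)Y^{(0)}+DY^{(1)}$ almost surely. No potential treatments $D^{(z)}$ are assumed to exist. Put $ATE=\mathbb E[Y^{(1)}-Y^{(0)}]$. For an observed law $\mathcal P$ with $\mathcal P(Z=z)>0$ for both $z$, let $p_{yd,z}=\mathcal P(Y=\gamma_y,D=d\mid Z=z)$, and let $\bar p_{yd,z}=p_{y(1-d),z}$ be the corresponding probabilities of the conjugate law $\bar{\mathcal P}(Y=y,D=d,Z=z)=\mathcal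 P(Y=y,D=1-d,Z=z)$. A binary array $B=(B_{ydz})_{y\in[n],\,d,z\in\{0,1\}}$ is called an admissible signature, with constant $\alpha=\alpha(B)$, if one of the following holds. - ($S_1$) There is $t$ with $0\le t<n-1$ such that $B_{i00}=B_{i01}=1$ for $i\ge t$ and $B_{i00}\ne B_{i01}$ for $i<t$; $B_{i10}\neq B_{i11}$ for all $i$; and $B_{i10}=B_{j11}=1$ for some $i,j$. Then $\alpha=-\gamma_0-\gamma_t$. - ($S_2$) $B_{(n-1)00}=B_{(n-1)01}=B_{010}=B_{011}=1$; $B_{i00}\ne B_{i01}$ for $i<n-1$; $B_{j10}\ne B_{j11}$ for $j>0$. Then $\alpha=-\gamma_0-\gamma_{n-1}$. - ($S_3$) There is $t$ with $0<t\le n-1$ such that $B_{i10}=B_{i11}=1$ for $i\le t$ and $B_{i10}\ne B_{i11}$ for $i>t$; $B_{i00}\ne B_{i01}$ for all $i$; and $B_{i00}=B_{j01}=1$ for some $i,j$. Then $\alpha=-\gamma_t-\gamma_{n-1}$. (At most one case applies to a given $B$, with a unique $t$.) For an admissible $B$ let $u(B)=(u_{ydz})$ be given by $u_{i00}=-\gamma_i-\alpha$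 if $B_{i00}=1$ and $\gamma_0$ otherwise; $u_{i10}=\gamma_i$ if $B_{i10}=1$ and $-\gamma_{n-1}-\alpha$ otherwise; $u_{i01}=-\gamma_i$ if $B_{i01}=1$ and $\gamma_0+\alpha$ otherwise; $u_{i11}=\gamma_i+\alpha$ if $B_{i11}=1$ and $-\gamma_{n-1}$ otherwise. Let $\mathcal V$ be the (finite, nonempty) set of all $u(B)$, write $v^\top p=\sum_{y,d,z}v_{ydz}\,p_{yd,z}$, and set $$L(\mathcal P)=\max_{v\in\mathcal V}v^\top p,\qquad U(\mathcal P)=-\max_{v\in\mathcal V}v^\top\bar p .$$ Theorem. The bounds $L(\mathcal P)\le ATE\le U(\mathcal P)$ are valid and sharp in the model 1–3. That is, (i) every full data law satisfying 1–3 with observed law $\mathcal P$ satisfies $L(\mathcal P)\le ATE\le U(\mathcal P)$; and (ii) for every $\mathcal P$ that is the observed law of some full data law satisfying 1–3, there are full data laws satisfying 1–3 with observed law $\mathcal P$ for which $ATE=L(\mathcal P)$ and $ATE=U(\mathcal P)$, respectively. -/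

import Mathlib

open MeasureTheory ProbabilityTheory

universe u

namespace BinaryIV

/-- The variables of the instrumental variable model with binary treatment, binary instrument and
outcome support `{γ 0, …, γ (n - 1)}`, on a common probability space: the potential outcomes
`pot d z = Y^(d,z)`, the observed treatment `D`, instrument `Z` and outcome `Y`.
No potential treatments `D^(z)` are part of the data. -/
structure FullData {n : ℕ} (γ : Fin n → ℝ) where
  /-- The sample space. -/
  Ω : Type u
  /-- Its σ-algebra. -/
  mΩ : MeasurableSpace Ω
  /-- The underlying probability measure. -/
  μ : Measure Ω
  isProb : IsProbabilityMeasure μ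
  /-- The potential outcomes `Y^(d,z)`. -/
  pot : Fin 2 → Fin 2 → Ω → ℝ
  /-- The treatment. -/
  D : Ω → Fin 2
  /-- The instrument. -/
  Z : Ω → Fin 2
  /-- The observed outcome. -/
  Y : Ω → ℝ
  measurable_pot : ∀ d z, Measurable (pot d z)
  measurable_D : Measurable D
  measurable_Z : Measurable Z
  measurable_Y : Measurable Y
  pot_mem : ∀ d z ω, pot d z ω ∈ Set.range γ
  Y_mem : ∀ ω, Y ω ∈ Set.range γ

attribute [instance] FullData.mΩ FullData.isProb

namespace FullData

variable {n : ℕ} {γ : Fin n → ℝ}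

/-- Individual-level exclusion: `Y^(d,z) = Y^(d,z')` almost surely. -/
def Exclusion (M : FullData.{u} γ) : Prop :=
  ∀ d z z', M.pot d z =ᵐ[M.μ] M.pot d z'

/-- The potential outcome `Y^(d)`; under exclusion the choice of `z = 0` is immaterial. -/
def potY (M : FullData.{u} γ) (d : Fin 2) : M.Ω → ℝ := M.pot d 0

/-- Joint independence: `Z` is independent of the pair `(Y^(0), Y^(1))`. -/
def JointIndependence (M : FullData.{u} γ) : Prop :=
  IndepFun M.Z (fun ω => (M.potY 0 ω, M.potY 1 ω)) M.μ

/-- Outcome consistency: `Y = (1 - D) Y^(0) + D Y^(1)` almost surely. -/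
def OutcomeConsistency (M : FullData.{u} γ) : Prop :=
  ∀ᵐ ω ∂M.μ, M.Y ω = (1 - ((M.D ω : ℕ) : ℝ)) * M.potY 0 ω + ((M.D ω : ℕ) : ℝ) * M.potY 1 ω

/-- The model given by exclusion, joint independence and outcome consistency. -/
def IsJointIV (M : FullData.{u} γ) : Prop :=
  M.Exclusion ∧ M.JointIndependence ∧ M.OutcomeConsistency

/-- The observed data law, the law of `(Y, D, Z)`. -/
noncomputable def observedLaw (M : FullData.{u} γ) : Measure (ℝ × Fin 2 × Fin 2) :=
  M.μ.map (fun ω => (M.Y ω, M.D ω, M.Z ω))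

/-- The average treatment effect `E[Y^(1) - Y^(0)]`. -/
noncomputable def ate (M : FullData.{u} γ) : ℝ :=
  ∫ ω, (M.potY 1 ω - M.potY 0 ω) ∂M.μ

end FullData

/-- The largest index `n - 1`. -/
def lastIdx (n : ℕ) [NeZero n] : Fin n := ⟨n - 1, Nat.sub_one_lt (NeZero.ne n)⟩

section Signatures

variable {n : ℕ} [NeZero n]

/-- Signatures of the first kind, with index `0 ≤ t < n - 1`;
`B y d z` is the entry of the binary vector `B` at `(y, d, z)`. -/
def IsS1 (t : Fin n) (B : Fin n → Fin 2 → Fin 2 → Bool) : Prop :=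
  t < lastIdx n ∧
  (∀ i, t ≤ i → B i 0 0 = true ∧ B i 0 1 = true) ∧
  (∀ i, i < t → B i 0 0 ≠ B i 0 1) ∧
  (∀ i, B i 1 0 ≠ B i 1 1) ∧
  (∃ i, B i 1 0 = true) ∧ (∃ j, B j 1 1 = true)

/-- Signatures of the second kind. -/
def IsS2 (B : Fin n → Fin 2 → Fin 2 → Bool) : Prop :=
  (B (lastIdx n) 0 0 = true ∧ B (lastIdx n) 0 1 = true ∧ B 0 1 0 = true ∧ B 0 1 1 = true) ∧
  (∀ i, i < lastIdx n → B i 0 0 ≠ B i 0 1) ∧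
  (∀ j, 0 < j → B j 1 0 ≠ B j 1 1)

/-- Signatures of the third kind, with index `0 < t ≤ n - 1`. -/
def IsS3 (t : Fin n) (B : Fin n → Fin 2 → Fin 2 → Bool) : Prop :=
  0 < t ∧
  (∀ i, i ≤ t → B i 1 0 = true ∧ B i 1 1 = true) ∧
  (∀ i, t < i → B i 1 0 ≠ B i 1 1) ∧
  (∀ i, B i 0 0 ≠ B i 0 1) ∧
  (∃ i, B i 0 0 = true) ∧ (∃ j, B j 0 1 = true)

/-- `B` is an admissible signature and `α` is the constant attached to it. (For a given `B` exactly
one of the three cases applies, with a unique `t`.) -/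
def AdmissibleWith (γ : Fin n → ℝ) (B : Fin n → Fin 2 → Fin 2 → Bool) (α : ℝ) : Prop :=
  (∃ t, IsS1 t B ∧ α = -γ 0 - γ t) ∨
  (IsS2 B ∧ α = -γ 0 - γ (lastIdx n)) ∨
  (∃ t, IsS3 t B ∧ α = -γ t - γ (lastIdx n))

/-- The vector `u(B)`, with entry `u_{ydz}` at `y d z`. -/
noncomputable def vertexMap (γ : Fin n → ℝ) (α : ℝ) (B : Fin n → Fin 2 → Fin 2 → Bool) :
    Fin n → Fin 2 → Fin 2 → ℝ := fun i =>
  ![![if B i 0 0 then -γ i - α else γ 0,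
      if B i 0 1 then -γ i else γ 0 + α],
    ![if B i 1 0 then γ i else -γ (lastIdx n) - α,
      if B i 1 1 then γ i + α else -γ (lastIdx n)]]

/-- The set `𝒱` of the vectors `u(B)`, over all admissible signatures `B`. -/
def vertexSet (γ : Fin n → ℝ) : Set (Fin n → Fin 2 → Fin 2 → ℝ) :=
  {v | ∃ B α, AdmissibleWith γ B α ∧ v = vertexMap γ α B}

theorem vertexSet_finite (γ : Fin n → ℝ) : (vertexSet γ).Finite := by
  refine (Set.finite_range (fun x : (Fin n → Fin 2 → Fin 2 → Bool) × Fin n × Fin n =>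
    vertexMap γ (-γ x.2.1 - γ x.2.2) x.1)).subset ?_
  rintro v ⟨B, α, ⟨t, -, rfl⟩ | ⟨-, rfl⟩ | ⟨t, -, rfl⟩, rfl⟩
  · exact ⟨(B, 0, t), rfl⟩
  · exact ⟨(B, 0, lastIdx n), rfl⟩
  · exact ⟨(B, t, lastIdx n), rfl⟩

theorem vertexSet_nonempty (γ : Fin n → ℝ) : (vertexSet γ).Nonempty := by
  classical
  refine ⟨_, fun i d z => if z = 0 then true else if d = 0 then decide (i = lastIdx n)
    else decide (i = 0), _, Or.inr (Or.inl ⟨⟨by simp, ?_, ?_⟩, rfl⟩), rfl⟩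
  · intro i hi
    simp [hi.ne]
  · intro j hj
    simp [hj.ne']

/-- The pairing `vᵀp = ∑_{y,d,z} v_{ydz} p_{ydz}`. -/
def dot (v p : Fin n → Fin 2 → Fin 2 → ℝ) : ℝ := ∑ y, ∑ d, ∑ z, v y d z * p y d z

/-- The conditional probabilities `p_{yd,z} = P(Y = γ_y, D = d ∣ Z = z)`. -/
noncomputable def condProbs (γ : Fin n → ℝ) (P : Measure (ℝ × Fin 2 × Fin 2)) :
    Fin n → Fin 2 → Fin 2 → ℝ := fun y d z =>
  (ProbabilityTheory.cond P {w | w.2.2 = z}).real {w | w.1 = γ y ∧ w.2.1 = d}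

/-- The conjugate law: `conj P (Y = y, D = d, Z = z) = P (Y = y, D = 1 - d, Z = z)`. -/
noncomputable def conjLaw (P : Measure (ℝ × Fin 2 × Fin 2)) : Measure (ℝ × Fin 2 × Fin 2) :=
  P.map (fun w => (w.1, 1 - w.2.1, w.2.2))

/-- `max_{v ∈ 𝒱} vᵀp`, for a vector `p`. -/
noncomputable def maxVertex (γ : Fin n → ℝ) (p : Fin n → Fin 2 → Fin 2 → ℝ) : ℝ :=
  sSup ((fun v => dot v p) '' vertexSet γ)

/-- The supremum defining `maxVertex` is a maximum. -/
theorem maxVertex_isGreatest (γ : Fin n → ℝ) (p : Fin n → Fin 2 → Fin 2 → ℝ) :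
    IsGreatest ((fun v => dot v p) '' vertexSet γ) (maxVertex γ p) := by
  have hf := (vertexSet_finite γ).image (fun v => dot v p)
  exact ⟨((vertexSet_nonempty γ).image _).csSup_mem hf,
    fun _ hx => le_csSup hf.bddAbove hx⟩

/-- The lower bound `L(P) = max_{v ∈ 𝒱} vᵀp`. -/
noncomputable def lowerBound (γ : Fin n → ℝ) (P : Measure (ℝ × Fin 2 × Fin 2)) : ℝ :=
  maxVertex γ (condProbs γ P)

/-- The upper bound `U(P) = - max_{v ∈ 𝒱} vᵀp̄`, with `p̄` the vector of the conjugate law. -/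
noncomputable def upperBound (γ : Fin n → ℝ) (P : Measure (ℝ × Fin 2 × Fin 2)) : ℝ :=
  -maxVertex γ (condProbs γ (conjLaw P))

end Signatures

end BinaryIV

universe v

/-!
A unit is described by its response type, consisting of its potential outcomes and of potential
treatments that are introduced for the purpose of the proof. The pairs formed by an observed law
and an average treatment effect compatible with it are the mixtures of response types. By linear
programming duality the smallest effect compatible with `p` is the maximum of `uᵀp` over the vectors
`u` that satisfy one inequality per response type.

Moving a constant between the entries with `z = 1` and those with `z = 0` does not change `uᵀp`.
Up to such a shift, a dual vector has all its entries below explicit caps depending on a single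
parameter `α`, and its remaining constraints only involve pairs of entries with the same `(y, d)`.
The optimal value for a given `α` is explicit, piecewise affine in `α` and bounded above, hence
maximal at a kink, and there the optimal vector is some `u(B)`. The signature `B` can fail to be
admissible only if `S₁` or `S₃` lacks one of its two existence clauses, and then a shift of `u(B)`
obeys the caps for `α = -γ₀ - γₙ₋₁`, where the optimal vector has a signature of type `S₂`.

Exchanging the two treatment levels turns the lower bound into the upper bound.
-/

namespace BinaryIV

theorem mem_of_forall_affine_minorant_le {E : Type*} [AddCommGroup E] [Module ℝ E]
    [TopologicalSpace E] [IsTopologicalAddGroup E] [ContinuousSMul ℝ E] [LocallyConvexSpace ℝ E]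
    {K : Set (E × ℝ)} (hK : Convex ℝ K) (hK' : IsClosed K) {x : E} {s θ : ℝ} (hs : (x, s) ∈ K)
    (hθ : θ ≤ s)
    (h : ∀ (f : E →L[ℝ] ℝ) (m : ℝ), (∀ q ∈ K, f q.1 + m ≤ q.2) → f x + m ≤ θ) :
    (x, θ) ∈ K := by
  by_contra hx
  obtain ⟨F, c, hF, hc⟩ := geometric_hahn_banach_closed_point hK hK' hx
  set k : ℝ := -F (0, 1) with hk
  have F_apply (y : E) (t : ℝ) : F (y, t) = F (y, 0) - t * k := by
    rw [hk, mul_neg, sub_neg_eq_add, ← smul_eq_mul, ← map_smul, ← map_add]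
    simp
  have k_pos : 0 < k := by
    have := (hF _ hs).trans hc
    rw [F_apply, F_apply x θ] at this
    nlinarith
  have minorant_iff (y : E) (t : ℝ) :
      (k⁻¹ • F.comp (.inl ℝ E ℝ)) y + -(k⁻¹ * c) ≤ t ↔ F (y, t) ≤ c := by
    change k⁻¹ * F (y, 0) + -(k⁻¹ * c) ≤ t ↔ _
    rw [← sub_eq_add_neg, ← mul_sub, inv_mul_le_iff₀ k_pos, F_apply y t, sub_le_comm, mul_comm]
  exact hc.not_ge <| (minorant_iff x θ).1 <| h _ _ fun q hq => (minorant_iff q.1 q.2).2 (hF q hq).le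

section ResponsePolytope

/-- A deterministic unit: its potential outcomes `y^(d)`, as indices into the outcome support, and
its potential treatments `d^(z)`. The latter are a computational device, not part of the model. -/
abbrev ResponseType (n : ℕ) : Type := (Fin 2 → Fin n) × (Fin 2 → Fin 2)

variable {n : ℕ}

/-- The conditional law of `(Y, D)` given `Z = z` in a population consisting of units of the
response type `r` only, arranged like `condProbs`. -/
def ResponseType.condProb (r : ResponseType n) : Fin n → Fin 2 → Fin 2 → ℝ :=
  fun y d z => if r.2 z = d ∧ r.1 d = y then 1 else 0

/-- The treatment effect `y^(1) - y^(0)` of a unit of response type `r`. -/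
def ResponseType.effect (γ : Fin n → ℝ) (r : ResponseType n) : ℝ := γ (r.1 1) - γ (r.1 0)

/-- The pairs `(p, θ)` of conditional observed probabilities and average treatment effect attained
by mixtures of response types. -/
def responsePolytope (γ : Fin n → ℝ) : Set ((Fin n → Fin 2 → Fin 2 → ℝ) × ℝ) :=
  convexHull ℝ (Set.range fun r : ResponseType n => (r.condProb, r.effect γ))

theorem convex_responsePolytope (γ : Fin n → ℝ) : Convex ℝ (responsePolytope γ) :=
  convex_convexHull ℝ _

theorem isClosed_responsePolytope (γ : Fin n → ℝ) : IsClosed (responsePolytope γ) :=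
  (Set.finite_range _).isClosed_convexHull ℝ

/-- The constraints dual to the response types: the functional `dot u` stays below the treatment
effect on each response type. -/
def IsDualFeasible (γ : Fin n → ℝ) (u : Fin n → Fin 2 → Fin 2 → ℝ) : Prop :=
  ∀ (y : Fin 2 → Fin n) (d : Fin 2 → Fin 2), ∑ z, u (y (d z)) (d z) z ≤ γ (y 1) - γ (y 0)

theorem dot_eq_sum (v p : Fin n → Fin 2 → Fin 2 → ℝ) :
    dot v p = ∑ z, ∑ d, ∑ y, v y d z * p y d z := by
  rw [dot, Finset.sum_comm' (t' := Finset.univ) (s' := fun _ => Finset.univ) (by simp)]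
  simp_rw [Finset.sum_comm (s := (Finset.univ : Finset (Fin n)))]
  exact Finset.sum_comm

theorem dot_condProb (u : Fin n → Fin 2 → Fin 2 → ℝ) (r : ResponseType n) :
    dot u r.condProb = ∑ z, u (r.1 (r.2 z)) (r.2 z) z := by
  simp [dot_eq_sum, ResponseType.condProb, ite_and]

theorem isLinearMap_dot (u : Fin n → Fin 2 → Fin 2 → ℝ) : IsLinearMap ℝ (dot u) where
  map_add p q := by simp [dot, mul_add, Finset.sum_add_distrib]
  map_smul c p := by simp [dot, Finset.mul_sum, mul_left_comm, mul_add]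

theorem responsePolytope_subset {γ : Fin n → ℝ} {K : Set ((Fin n → Fin 2 → Fin 2 → ℝ) × ℝ)}
    (hK : Convex ℝ K) (h : ∀ r : ResponseType n, (r.condProb, r.effect γ) ∈ K) :
    responsePolytope γ ⊆ K :=
  convexHull_min (Set.range_subset_iff.2 h) hK

theorem IsDualFeasible.dot_le {γ : Fin n → ℝ} {u p : Fin n → Fin 2 → Fin 2 → ℝ} {θ : ℝ}
    (hu : IsDualFeasible γ u) (hp : (p, θ) ∈ responsePolytope γ) : dot u p ≤ θ := by
  let f : (Fin n → Fin 2 → Fin 2 → ℝ) × ℝ →ₗ[ℝ] ℝ :=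
    (isLinearMap_dot u).mk' _ ∘ₗ .fst ℝ _ ℝ - .snd ℝ _ ℝ
  have : responsePolytope γ ⊆ {q | f q ≤ 0} := responsePolytope_subset
    (convex_halfSpace_le f.isLinear 0) fun r => by
      simpa [f, dot_condProb, ResponseType.effect] using hu r.1 r.2
  simpa [f] using this hp

theorem nonneg_of_mem_responsePolytope {γ : Fin n → ℝ} {p : Fin n → Fin 2 → Fin 2 → ℝ} {θ : ℝ}
    (hp : (p, θ) ∈ responsePolytope γ) (y : Fin n) (d z : Fin 2) : 0 ≤ p y d z := by
  let f : (Fin n → Fin 2 → Fin 2 → ℝ) × ℝ →ₗ[ℝ] ℝ :=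
    .proj z ∘ₗ .proj d ∘ₗ .proj y ∘ₗ .fst ℝ _ ℝ
  have : responsePolytope γ ⊆ {q | 0 ≤ f q} := responsePolytope_subset
    (convex_halfSpace_ge f.isLinear 0) fun r => by
      simp only [ResponseType.condProb, LinearMap.coe_comp, LinearMap.coe_proj,
        Function.comp_apply, LinearMap.fst_apply, Function.eval, Set.mem_ofPred_eq, f]
      positivity
  simpa [f] using this hp

theorem sum_eq_one_of_mem_responsePolytope {γ : Fin n → ℝ} {p : Fin n → Fin 2 → Fin 2 → ℝ} {θ : ℝ}
    (hp : (p, θ) ∈ responsePolytope γ) (z : Fin 2) : ∑ y, ∑ d, p y d z = 1 := by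
  let f : (Fin n → Fin 2 → Fin 2 → ℝ) × ℝ →ₗ[ℝ] ℝ :=
    ∑ y, ∑ d, .proj z ∘ₗ .proj d ∘ₗ .proj y ∘ₗ .fst ℝ _ ℝ
  have : responsePolytope γ ⊆ {q | f q = 1} := responsePolytope_subset
    (convex_hyperplane f.isLinear 1) fun r => by
      have : ∑ y, ∑ d, r.condProb y d z = 1 := by
        rw [Finset.sum_comm]
        simp [ResponseType.condProb, ite_and, -Fin.sum_univ_two]
      simpa [f] using this
  simpa [f] using this hp

theorem apply_eq_dot_single (f : (Fin n → Fin 2 → Fin 2 → ℝ) →ₗ[ℝ] ℝ)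
    (p : Fin n → Fin 2 → Fin 2 → ℝ) :
    f p = dot (fun y d z => f (Pi.single y (Pi.single d (Pi.single z 1)))) p := by
  have : p = ∑ y, ∑ d, ∑ z, p y d z • Pi.single y (Pi.single d (Pi.single z 1)) := by
    ext y d z
    simp [Finset.sum_apply, Pi.single_apply, ite_apply, -Fin.sum_univ_two]
  conv_lhs => rw [this]
  simp [dot, mul_comm, -Fin.sum_univ_two]

theorem mem_responsePolytope_of_forall_dot_le {γ : Fin n → ℝ} {p : Fin n → Fin 2 → Fin 2 → ℝ}
    {s θ : ℝ} (hs : (p, s) ∈ responsePolytope γ) (hθ : θ ≤ s)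
    (h : ∀ u, IsDualFeasible γ u → dot u p ≤ θ) : (p, θ) ∈ responsePolytope γ := by
  refine mem_of_forall_affine_minorant_le (convex_responsePolytope γ) (isClosed_responsePolytope γ)
    hs hθ fun f m hf => ?_
  -- Adding `m` to the entries with `z = 0` absorbs the constant, as these probabilities sum to one.
  let u : Fin n → Fin 2 → Fin 2 → ℝ := fun y d z =>
    f (Pi.single y (Pi.single d (Pi.single z 1))) + if z = 0 then m else 0
  have dot_u {q : Fin n → Fin 2 → Fin 2 → ℝ} {t : ℝ} (hq : (q, t) ∈ responsePolytope γ) :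
      dot u q = f q + m := by
    have : dot (fun _ _ z => if z = 0 then m else 0) q = m := by
      have := sum_eq_one_of_mem_responsePolytope hq 0
      simp_all [dot, ← Finset.mul_sum]
    calc dot u q = dot (fun y d z => f (Pi.single y (Pi.single d (Pi.single z 1)))) q +
          dot (fun _ _ z => if z = 0 then m else 0) q := by
          simp only [u, dot, add_mul, Finset.sum_add_distrib]
      _ = f q + m := by
          rw [this]
          exact congr_arg (· + m) (apply_eq_dot_single f.toLinearMap q).symm
  rw [← dot_u hs]
  refine h u fun y d => ?_
  have hr := subset_convexHull ℝ _ (Set.mem_range_self (f := fun r : ResponseType n =>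
    (r.condProb, r.effect γ)) (y, d))
  have := hf _ hr
  rwa [← dot_u hr, dot_condProb] at this

end ResponsePolytope

theorem nonpos_of_forall_mul_le {σ C : ℝ} (h : ∀ t, 0 ≤ t → σ * t ≤ C) : σ ≤ 0 := by
  by_contra! hσ
  have := h ((|C| + 1) / σ) (by positivity)
  rw [mul_div_cancel₀ _ hσ.ne'] at this
  linarith [le_abs_self C]

/-- The points `y` such that no knot `a k` separates `y` from `x`. -/
def knotCell {ι : Type*} (a : ι → ℝ) (x : ℝ) : Set ℝ :=
  {y | ∀ k, a k ≤ x ∧ a k ≤ y ∨ x < a k ∧ y ≤ a k}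

theorem exists_slope_on_knotCell {ι : Type*} [Fintype ι] (a m : ι → ℝ) (κ x : ℝ) :
    ∃ σ : ℝ, ∀ y ∈ knotCell a x,
      κ * y - ∑ k, m k * |y - a k| = κ * x - ∑ k, m k * |x - a k| + σ * (y - x) := by
  refine ⟨κ - ∑ k, m k * if a k ≤ x then 1 else -1, fun y hy => ?_⟩
  have abs_eq (k : ι) : |y - a k| = |x - a k| + (if a k ≤ x then 1 else -1) * (y - x) := by
    rcases hy k with ⟨h, h'⟩ | ⟨h, h'⟩
    · rw [if_pos h, abs_of_nonneg (sub_nonneg.2 h), abs_of_nonneg (sub_nonneg.2 h')]; ring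
    · rw [if_neg h.not_ge, abs_of_neg (sub_neg.2 h), abs_of_nonpos (sub_nonpos.2 h')]; ring
  simp only [abs_eq, mul_add, Finset.sum_add_distrib, sub_mul, Finset.sum_mul, mul_assoc]
  ring

theorem exists_le_apply_knot {ι : Type*} [Fintype ι] [Nonempty ι] (a m : ι → ℝ) (κ : ℝ)
    (hbdd : BddAbove (Set.range fun x => κ * x - ∑ k, m k * |x - a k|)) (x : ℝ) :
    ∃ k, κ * x - ∑ l, m l * |x - a l| ≤ κ * a k - ∑ l, m l * |a k - a l| := by
  obtain ⟨C, hC⟩ := hbdd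
  obtain ⟨σ, hσ⟩ := exists_slope_on_knotCell a m κ x
  set f : ℝ → ℝ := fun x => κ * x - ∑ k, m k * |x - a k|
  change ∀ y ∈ knotCell a x, f y = f x + σ * (y - x) at hσ
  change ∃ k, f x ≤ f (a k)
  have knot_of_mem {k : ι} (hk : a k ∈ knotCell a x) (h : 0 ≤ σ * (a k - x)) :
      ∃ k, f x ≤ f (a k) :=
    ⟨k, by linarith [hσ _ hk]⟩
  have of_left (hl : ∃ k, a k ≤ x) (hneg : σ ≤ 0) : ∃ k, f x ≤ f (a k) := by
    obtain ⟨k, hk, hmax⟩ := Set.exists_max_image {k | a k ≤ x} a (Set.toFinite _) hl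
    refine knot_of_mem (fun l => ?_) (mul_nonneg_of_nonpos_of_nonpos hneg (sub_nonpos.2 hk))
    exact (le_or_gt (a l) x).imp (fun h => ⟨h, hmax l h⟩) fun h => ⟨h, le_trans hk h.le⟩
  have of_right (hr : ∃ k, x < a k) (hpos : 0 ≤ σ) : ∃ k, f x ≤ f (a k) := by
    obtain ⟨k, hk, hmin⟩ := Set.exists_min_image {k | x < a k} a (Set.toFinite _) hr
    refine knot_of_mem (fun l => ?_) (mul_nonneg hpos (sub_nonneg.2 (le_of_lt hk)))
    exact (le_or_gt (a l) x).imp (fun h => ⟨h, h.trans (le_of_lt hk)⟩) fun h => ⟨h, hmin l h⟩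
  have le_bound {y : ℝ} (hy : y ∈ knotCell a x) : σ * (y - x) ≤ C - f x := by
    linarith [hσ y hy, hC ⟨y, rfl⟩]
  obtain ⟨k₀⟩ := ‹Nonempty ι›
  rcases le_total 0 σ with hpos | hneg
  · by_cases hr : ∃ k, x < a k
    · exact of_right hr hpos
    push Not at hr
    refine of_left ⟨k₀, hr k₀⟩ (nonpos_of_forall_mul_le (C := C - f x) fun t ht => ?_)
    simpa using le_bound (y := x + t) fun k => .inl ⟨hr k, by linarith [hr k]⟩
  · by_cases hl : ∃ k, a k ≤ x
    · exact of_left hl hneg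
    push Not at hl
    refine of_right ⟨k₀, hl k₀⟩ (neg_nonpos.1 <|
      nonpos_of_forall_mul_le (C := C - f x) fun t ht => ?_)
    simpa using le_bound (y := x - t) fun k => .inr ⟨hl k, by linarith [hl k]⟩

/-- The vector `u` with a constant `c` moved from the entries with `z = 1` to those with `z = 0`. -/
def shift {n : ℕ} (c : ℝ) (u : Fin n → Fin 2 → Fin 2 → ℝ) : Fin n → Fin 2 → Fin 2 → ℝ :=
  fun y d z => u y d z + ![c, -c] z

theorem shift_zero {n : ℕ} (c : ℝ) (u : Fin n → Fin 2 → Fin 2 → ℝ) (y : Fin n) (d : Fin 2) :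
    shift c u y d 0 = u y d 0 + c := rfl

theorem shift_one {n : ℕ} (c : ℝ) (u : Fin n → Fin 2 → Fin 2 → ℝ) (y : Fin n) (d : Fin 2) :
    shift c u y d 1 = u y d 1 - c :=
  (sub_eq_add_neg _ _).symm

theorem shift_add_shift {n : ℕ} (c : ℝ) (u : Fin n → Fin 2 → Fin 2 → ℝ) (y : Fin n) (d : Fin 2) :
    shift c u y d 0 + shift c u y d 1 = u y d 0 + u y d 1 := by
  rw [shift_zero, shift_one, add_add_sub_cancel]

theorem dot_shift {n : ℕ} (c : ℝ) (u : Fin n → Fin 2 → Fin 2 → ℝ) {p : Fin n → Fin 2 → Fin 2 → ℝ}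
    (hp : ∑ y, ∑ d, p y d 0 = ∑ y, ∑ d, p y d 1) : dot (shift c u) p = dot u p := by
  have : dot (fun _ _ z => ![c, -c] z) p = 0 := by
    simp_all [dot, Finset.sum_add_distrib, ← Finset.mul_sum]
  simp only [shift, dot, add_mul, Finset.sum_add_distrib] at this ⊢
  rw [this, add_zero]

section Profile

variable {n : ℕ}

/-- Upper bounds on the entries of a dual vector, at level `α`. They make the constraints between
the entries for `d = 0` and those for `d = 1` hold, so that only constraints on the pairs of
entries that share `y` and `d` remain. -/
def cap (γ : Fin n → ℝ) (α : ℝ) : Fin n → Fin 2 → Fin 2 → ℝ := fun i =>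
  ![![-γ i - α, -γ i], ![γ i, γ i + α]]

theorem le_cap_iff {γ : Fin n → ℝ} {α : ℝ} {i : Fin n} {u : Fin 2 → Fin 2 → ℝ} :
    (∀ d z, u d z ≤ cap γ α i d z) ↔
      (u 0 0 ≤ -γ i - α ∧ u 0 1 ≤ -γ i) ∧ u 1 0 ≤ γ i ∧ u 1 1 ≤ γ i + α := by
  simp only [Fin.forall_fin_two]
  rfl

variable [NeZero n]

theorem le_lastIdx (i : Fin n) : i ≤ lastIdx n := Fin.le_def.2 (Nat.le_sub_one_of_lt i.2)

/-- The upper bound on the sum of the two entries of a dual vector that share `y` and `d`. -/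
def pairCap (γ : Fin n → ℝ) : Fin n → Fin 2 → ℝ := fun i => ![γ 0 - γ i, γ i - γ (lastIdx n)]

/-- The amount by which two entries equal to `cap` violate `pairCap`. -/
def excess (γ : Fin n → ℝ) (α : ℝ) (i : Fin n) (d : Fin 2) : ℝ :=
  cap γ α i d 0 + cap γ α i d 1 - pairCap γ i d

/-- The level at which `excess` changes its sign. -/
def knot (γ : Fin n → ℝ) : Fin n × Fin 2 → ℝ := fun k =>
  ![-γ 0 - γ k.1, -γ k.1 - γ (lastIdx n)] k.2

theorem knot_zero (γ : Fin n → ℝ) (i : Fin n) : knot γ (i, 0) = -γ 0 - γ i := rfl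

theorem knot_one (γ : Fin n → ℝ) (i : Fin n) : knot γ (i, 1) = -γ i - γ (lastIdx n) := rfl

theorem excess_zero (γ : Fin n → ℝ) (α : ℝ) (i : Fin n) : excess γ α i 0 = -γ 0 - γ i - α := by
  change -γ i - α + -γ i - (γ 0 - γ i) = _
  ring

theorem excess_one (γ : Fin n → ℝ) (α : ℝ) (i : Fin n) :
    excess γ α i 1 = γ i + γ (lastIdx n) + α := by
  change γ i + (γ i + α) - (γ i - γ (lastIdx n)) = _
  ring

theorem abs_excess (γ : Fin n → ℝ) (α : ℝ) (k : Fin n × Fin 2) :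
    |excess γ α k.1 k.2| = |α - knot γ k| := by
  obtain ⟨i, d⟩ := k
  obtain rfl | rfl : d = 0 ∨ d = 1 := by omega
  · rw [excess_zero, knot_zero, abs_sub_comm]
  · rw [excess_one, knot_one]
    ring_nf

theorem vertexMap_apply (γ : Fin n → ℝ) (α : ℝ) (B : Fin n → Fin 2 → Fin 2 → Bool) (i : Fin n)
    (d z : Fin 2) : vertexMap γ α B i d z =
      if B i d z then cap γ α i d z else cap γ α i d z - excess γ α i d := by
  have lowered_zero : -γ i - α - excess γ α i 0 = γ 0 ∧ -γ i - excess γ α i 0 = γ 0 + α := by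
    rw [excess_zero]
    constructor <;> ring
  have lowered_one : γ i - excess γ α i 1 = -γ (lastIdx n) - α ∧
      γ i + α - excess γ α i 1 = -γ (lastIdx n) := by
    rw [excess_one]
    constructor <;> ring
  fin_cases d <;> fin_cases z
  · exact congr_arg (ite _ _) lowered_zero.1.symm
  · exact congr_arg (ite _ _) lowered_zero.2.symm
  · exact congr_arg (ite _ _) lowered_one.1.symm
  · exact congr_arg (ite _ _) lowered_one.2.symm

/-- Dual vectors that respect `cap` at level `α` and `pairCap`. -/
structure IsCapped (γ : Fin n → ℝ) (α : ℝ) (u : Fin n → Fin 2 → Fin 2 → ℝ) : Prop where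
  le_cap : ∀ i d z, u i d z ≤ cap γ α i d z
  add_le_pairCap : ∀ i d, u i d 0 + u i d 1 ≤ pairCap γ i d

theorem IsCapped.isDualFeasible {γ : Fin n → ℝ} (hγ : Monotone γ) {α : ℝ}
    {u : Fin n → Fin 2 → Fin 2 → ℝ} (hu : IsCapped γ α u) : IsDualFeasible γ u := by
  intro y d
  have h0 : γ 0 ≤ γ (y 1) := hγ (Fin.zero_le _)
  have h1 : γ (y 0) ≤ γ (lastIdx n) := hγ (le_lastIdx _)
  have hcap (e : Fin 2) := le_cap_iff.1 (hu.le_cap (y e))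
  have control : u (y 0) 0 0 + u (y 0) 0 1 ≤ γ 0 - γ (y 0) := hu.add_le_pairCap (y 0) 0
  have treated : u (y 1) 1 0 + u (y 1) 1 1 ≤ γ (y 1) - γ (lastIdx n) := hu.add_le_pairCap (y 1) 1
  rw [Fin.sum_univ_two]
  obtain h | h : d 0 = 0 ∨ d 0 = 1 := by omega
  all_goals
    obtain h' | h' : d 1 = 0 ∨ d 1 = 1 := by omega
    all_goals
      rw [h, h']
      linarith [hcap 0, hcap 1]

theorem IsDualFeasible.exists_isCapped_shift {γ : Fin n → ℝ} {u : Fin n → Fin 2 → Fin 2 → ℝ}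
    (hu : IsDualFeasible γ u) : ∃ α c, IsCapped γ α (shift c u) := by
  obtain ⟨i₀, hi₀⟩ := Finite.exists_max fun i => u i 0 0 + γ i
  obtain ⟨i₁, hi₁⟩ := Finite.exists_max fun i => u i 0 1 + γ i
  refine ⟨-(u i₀ 0 0 + γ i₀) - (u i₁ 0 1 + γ i₁), u i₁ 0 1 + γ i₁, fun i => ?_, fun i => ?_⟩
  · have complier : u i₀ 0 0 + u i 1 1 ≤ γ i - γ i₀ := by simpa using hu ![i₀, i] ![0, 1]
    have defier : u i 1 0 + u i₁ 0 1 ≤ γ i - γ i₁ := by simpa using hu ![i₁, i] ![1, 0]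
    simp only [le_cap_iff, shift_zero, shift_one]
    refine ⟨⟨?_, ?_⟩, ?_, ?_⟩ <;> linarith [hi₀ i, hi₁ i]
  · have never_taker : u i 0 0 + u i 0 1 ≤ γ 0 - γ i := by simpa using hu ![i, 0] ![0, 0]
    have always_taker : u i 1 0 + u i 1 1 ≤ γ i - γ (lastIdx n) := by
      simpa using hu ![lastIdx n, i] ![1, 1]
    simp only [shift_add_shift, Fin.forall_fin_two]
    exact ⟨never_taker, always_taker⟩

/-- The largest value of `dot u p` over the vectors `u` that are capped at level `α`. -/
noncomputable def dualProfile (γ : Fin n → ℝ) (p : Fin n → Fin 2 → Fin 2 → ℝ) (α : ℝ) : ℝ :=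
  ∑ i, ∑ d, (∑ z, cap γ α i d z * p i d z - max (excess γ α i d) 0 * min (p i d 0) (p i d 1))

theorem max_zero_mul_min_le {x y k a b : ℝ} (hx : 0 ≤ x) (hy : 0 ≤ y) (hk : k ≤ x + y)
    (ha : 0 ≤ a) (hb : 0 ≤ b) : max k 0 * min a b ≤ x * a + y * b :=
  calc max k 0 * min a b ≤ (x + y) * min a b :=
        mul_le_mul_of_nonneg_right (max_le hk (add_nonneg hx hy)) (le_min ha hb)
    _ = x * min a b + y * min a b := add_mul _ _ _
    _ ≤ x * a + y * b := add_le_add (mul_le_mul_of_nonneg_left (min_le_left _ _) hx)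
        (mul_le_mul_of_nonneg_left (min_le_right _ _) hy)

theorem IsCapped.dot_le_dualProfile {γ : Fin n → ℝ} {α : ℝ} {u p : Fin n → Fin 2 → Fin 2 → ℝ}
    (hu : IsCapped γ α u) (hp : ∀ y d z, 0 ≤ p y d z) : dot u p ≤ dualProfile γ p α := by
  refine Finset.sum_le_sum fun i _ => Finset.sum_le_sum fun d _ => ?_
  have := max_zero_mul_min_le (sub_nonneg.2 (hu.le_cap i d 0)) (sub_nonneg.2 (hu.le_cap i d 1))
    (k := excess γ α i d) (by linarith [hu.add_le_pairCap i d, excess.eq_1 γ α i d])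
    (hp i d 0) (hp i d 1)
  simp only [Fin.sum_univ_two]
  linarith

/-- A signature for which `vertexMap` lowers an entry of a pair by `excess` exactly when the pair
would violate `pairCap` otherwise. -/
def IsCompatible (γ : Fin n → ℝ) (α : ℝ) (B : Fin n → Fin 2 → Fin 2 → Bool) : Prop :=
  ∀ i d, (excess γ α i d ≤ 0 ∧ B i d 0 = true ∧ B i d 1 = true) ∨
    (0 ≤ excess γ α i d ∧ B i d 0 ≠ B i d 1)

theorem IsCompatible.isCapped {γ : Fin n → ℝ} {α : ℝ} {B : Fin n → Fin 2 → Fin 2 → Bool}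
    (hB : IsCompatible γ α B) : IsCapped γ α (vertexMap γ α B) := by
  refine ⟨fun i d z => ?_, fun i d => ?_⟩
  · rw [vertexMap_apply]
    split_ifs with h
    · rfl
    · have : 0 ≤ excess γ α i d := by
        refine (hB i d).elim (fun h' => ?_) And.left
        obtain rfl | rfl : z = 0 ∨ z = 1 := by omega
        all_goals simp_all
      linarith
  · have sub_excess : cap γ α i d 0 + cap γ α i d 1 - excess γ α i d = pairCap γ i d :=
      sub_sub_cancel _ _
    simp only [vertexMap_apply]
    rcases hB i d with ⟨h, h0, h1⟩ | ⟨-, hne⟩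
    · rw [if_pos h0, if_pos h1]
      linarith
    · cases h0 : B i d 0 <;> cases h1 : B i d 1
      all_goals simp only [h0, h1, ne_eq, not_true_eq_false] at hne
      all_goals simp only [if_true, Bool.false_eq_true, if_false]; linarith

theorem AdmissibleWith.isCompatible {γ : Fin n → ℝ} (hγ : Monotone γ)
    {B : Fin n → Fin 2 → Fin 2 → Bool} {α : ℝ} (h : AdmissibleWith γ B α) :
    IsCompatible γ α B := by
  have h0 : ∀ i, γ 0 ≤ γ i := fun i => hγ (Fin.zero_le i)
  have h1 : ∀ i, γ i ≤ γ (lastIdx n) := fun i => hγ (le_lastIdx i)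
  simp only [IsCompatible, Fin.forall_fin_two, excess_zero, excess_one]
  rcases h with ⟨t, ⟨-, ha, hb, hc, -⟩, rfl⟩ | ⟨⟨⟨ha, ha', hb, hb'⟩, hc, hd⟩, rfl⟩ |
    ⟨t, ⟨-, ha, hb, hc, -⟩, rfl⟩
  · refine fun i => ⟨?_, .inr ⟨by linarith [h0 i, h1 t], hc i⟩⟩
    exact (le_or_gt t i).imp (fun hi => ⟨by linarith [hγ hi], ha i hi⟩)
      fun hi => ⟨by linarith [hγ hi.le], hb i hi⟩
  · refine fun i => ⟨?_, ?_⟩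
    · rcases (le_lastIdx i).eq_or_lt with rfl | hi
      · exact .inl ⟨by linarith, ha, ha'⟩
      · exact .inr ⟨by linarith [h1 i], hc i hi⟩
    · rcases (Fin.zero_le i).eq_or_lt with rfl | hi
      · exact .inl ⟨by linarith, hb, hb'⟩
      · exact .inr ⟨by linarith [h0 i], hd i hi⟩
  · refine fun i => ⟨.inr ⟨by linarith [h0 t, h1 i], hc i⟩, ?_⟩
    exact (le_or_gt i t).imp (fun hi => ⟨by linarith [hγ hi], ha i hi⟩)
      fun hi => ⟨by linarith [hγ hi.le], hb i hi⟩

/-- The signature that, at each pair with positive excess, lowers the entry paired with the smaller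
of the two probabilities. -/
noncomputable def optimalSignature (γ : Fin n → ℝ) (p : Fin n → Fin 2 → Fin 2 → ℝ) (α : ℝ) :
    Fin n → Fin 2 → Fin 2 → Bool := fun i d z =>
  decide (excess γ α i d ≤ 0 ∨ (z = 0 ↔ p i d 1 < p i d 0))

theorem optimalSignature_of_nonpos {γ : Fin n → ℝ} {α : ℝ} {i : Fin n} {d : Fin 2}
    (h : excess γ α i d ≤ 0) (p : Fin n → Fin 2 → Fin 2 → ℝ) (z : Fin 2) :
    optimalSignature γ p α i d z = true := by
  simp [optimalSignature, h]

theorem optimalSignature_ne_of_pos {γ : Fin n → ℝ} {α : ℝ} {i : Fin n} {d : Fin 2}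
    (h : 0 < excess γ α i d) (p : Fin n → Fin 2 → Fin 2 → ℝ) :
    optimalSignature γ p α i d 0 ≠ optimalSignature γ p α i d 1 := by
  by_cases h' : p i d 1 < p i d 0 <;> simp [optimalSignature, h.not_ge, h']

theorem isCompatible_optimalSignature (γ : Fin n → ℝ) (p : Fin n → Fin 2 → Fin 2 → ℝ) (α : ℝ) :
    IsCompatible γ α (optimalSignature γ p α) := fun i d =>
  (le_or_gt (excess γ α i d) 0).imp
    (fun h => ⟨h, optimalSignature_of_nonpos h p 0, optimalSignature_of_nonpos h p 1⟩)
    fun h => ⟨h.le, optimalSignature_ne_of_pos h p⟩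

theorem dot_vertexMap_optimalSignature (γ : Fin n → ℝ) (p : Fin n → Fin 2 → Fin 2 → ℝ) (α : ℝ) :
    dot (vertexMap γ α (optimalSignature γ p α)) p = dualProfile γ p α := by
  refine Finset.sum_congr rfl fun i _ => Finset.sum_congr rfl fun d _ => ?_
  simp only [Fin.sum_univ_two, vertexMap_apply]
  rcases le_or_gt (excess γ α i d) 0 with h | h
  · simp [optimalSignature_of_nonpos h, h]
  · rw [max_eq_left h.le]
    rcases lt_or_ge (p i d 1) (p i d 0) with h' | h'
    · have signature : optimalSignature γ p α i d 0 = true ∧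
          optimalSignature γ p α i d 1 = false := by simp [optimalSignature, h, h']
      rw [signature.1, signature.2, min_eq_right h'.le, if_pos rfl, if_neg Bool.false_ne_true]
      ring
    · have signature : optimalSignature γ p α i d 0 = false ∧
          optimalSignature γ p α i d 1 = true := by simp [optimalSignature, h, h']
      rw [signature.1, signature.2, min_eq_left h', if_pos rfl, if_neg Bool.false_ne_true]
      ring

theorem exists_dualProfile_eq_add_mul_sub_sum_abs (γ : Fin n → ℝ) (p : Fin n → Fin 2 → Fin 2 → ℝ) :
    ∃ (c κ : ℝ) (m : Fin n × Fin 2 → ℝ),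
      ∀ α, dualProfile γ p α = c + (κ * α - ∑ k, m k * |α - knot γ k|) := by
  let m : Fin n × Fin 2 → ℝ := fun k => min (p k.1 k.2 0) (p k.1 k.2 1) / 2
  let slope : Fin n × Fin 2 → ℝ := fun k =>
    ![-p k.1 0 0 + m (k.1, 0), p k.1 1 1 - m (k.1, 1)] k.2
  have max_zero_eq (x : ℝ) : max x 0 = (x + |x|) / 2 := by
    simpa [mul_comm, div_eq_mul_inv] using sup_eq_half_smul_add_add_abs_sub' ℝ x 0
  have summand_eq (α : ℝ) (k : Fin n × Fin 2) :
      ∑ z, cap γ α k.1 k.2 z * p k.1 k.2 z - max (excess γ α k.1 k.2) 0 *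
        min (p k.1 k.2 0) (p k.1 k.2 1) =
      (∑ z, cap γ 0 k.1 k.2 z * p k.1 k.2 z - excess γ 0 k.1 k.2 * m k) + slope k * α -
        m k * |α - knot γ k| := by
    rw [max_zero_eq, abs_excess]
    obtain ⟨i, d⟩ := k
    obtain rfl | rfl : d = 0 ∨ d = 1 := by omega
    · change ∑ z, ![-γ i - α, -γ i] z * p i 0 z - _ = ∑ z, ![-γ i - 0, -γ i] z * p i 0 z - _ +
        (-p i 0 0 + m (i, 0)) * α - _
      simp only [Fin.sum_univ_two, excess_zero, m, Matrix.cons_val_zero, Matrix.cons_val_one]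
      ring
    · change ∑ z, ![γ i, γ i + α] z * p i 1 z - _ = ∑ z, ![γ i, γ i + 0] z * p i 1 z - _ +
        (p i 1 1 - m (i, 1)) * α - _
      simp only [Fin.sum_univ_two, excess_one, m, Matrix.cons_val_zero, Matrix.cons_val_one]
      ring
  refine ⟨∑ k : Fin n × Fin 2, (∑ z, cap γ 0 k.1 k.2 z * p k.1 k.2 z - excess γ 0 k.1 k.2 * m k),
    ∑ k, slope k, m, fun α => ?_⟩
  rw [dualProfile, ← Fintype.sum_prod_type'
    (f := fun i d => ∑ z, cap γ α i d z * p i d z - max (excess γ α i d) 0 * _)]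
  simp only [summand_eq, Finset.sum_sub_distrib, Finset.sum_add_distrib, Finset.sum_mul]
  ring

variable {γ : Fin n → ℝ} {p : Fin n → Fin 2 → Fin 2 → ℝ} {θ : ℝ}

theorem dualProfile_le_of_mem (hγ : Monotone γ) (hp : (p, θ) ∈ responsePolytope γ) (α : ℝ) :
    dualProfile γ p α ≤ θ := by
  rw [← dot_vertexMap_optimalSignature]
  exact ((isCompatible_optimalSignature γ p α).isCapped.isDualFeasible hγ).dot_le hp

theorem exists_dualProfile_le_knot (hγ : Monotone γ) (hp : (p, θ) ∈ responsePolytope γ) (α : ℝ) :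
    ∃ k, dualProfile γ p α ≤ dualProfile γ p (knot γ k) := by
  obtain ⟨c, κ, m, h⟩ := exists_dualProfile_eq_add_mul_sub_sum_abs γ p
  have hbdd : BddAbove (Set.range fun x => κ * x - ∑ k, m k * |x - knot γ k|) :=
    ⟨θ - c, Set.forall_mem_range.2 fun x => by linarith [h x, dualProfile_le_of_mem hγ hp x]⟩
  obtain ⟨k, hk⟩ := exists_le_apply_knot (knot γ) m κ hbdd α
  exact ⟨k, by rw [h, h]; linarith⟩

theorem dualProfile_le_maxVertex_of_admissibleWith {α : ℝ}
    (h : AdmissibleWith γ (optimalSignature γ p α) α) : dualProfile γ p α ≤ maxVertex γ p :=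
  (maxVertex_isGreatest γ p).2 ⟨_, ⟨_, _, h, rfl⟩, dot_vertexMap_optimalSignature γ p α⟩

theorem isS2_optimalSignature (hγ : StrictMono γ) (p : Fin n → Fin 2 → Fin 2 → ℝ) :
    IsS2 (optimalSignature γ p (-γ 0 - γ (lastIdx n))) := by
  have last_nonpos : excess γ (-γ 0 - γ (lastIdx n)) (lastIdx n) 0 ≤ 0 := by
    rw [excess_zero]; linarith
  have first_nonpos : excess γ (-γ 0 - γ (lastIdx n)) 0 1 ≤ 0 := by rw [excess_one]; linarith
  refine ⟨⟨optimalSignature_of_nonpos last_nonpos p 0, optimalSignature_of_nonpos last_nonpos p 1,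
    optimalSignature_of_nonpos first_nonpos p 0, optimalSignature_of_nonpos first_nonpos p 1⟩,
    fun i hi => ?_, fun j hj => ?_⟩
  · exact optimalSignature_ne_of_pos (by rw [excess_zero]; linarith [hγ hi]) p
  · exact optimalSignature_ne_of_pos (by rw [excess_one]; linarith [hγ hj]) p

theorem isS1_optimalSignature (hγ : StrictMono γ) {t : Fin n} (ht : t < lastIdx n)
    (h0 : ∃ i, optimalSignature γ p (knot γ (t, 0)) i 1 0 = true)
    (h1 : ∃ j, optimalSignature γ p (knot γ (t, 0)) j 1 1 = true) :
    IsS1 t (optimalSignature γ p (knot γ (t, 0))) := by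
  refine ⟨ht, fun i hi => ?_, fun i hi => ?_, fun j => ?_, h0, h1⟩
  · have : excess γ (knot γ (t, 0)) i 0 ≤ 0 := by
      rw [excess_zero, knot_zero]; linarith [hγ.monotone hi]
    exact ⟨optimalSignature_of_nonpos this p 0, optimalSignature_of_nonpos this p 1⟩
  · exact optimalSignature_ne_of_pos (by rw [excess_zero, knot_zero]; linarith [hγ hi]) p
  · refine optimalSignature_ne_of_pos ?_ p
    rw [excess_one, knot_zero]
    linarith [hγ ht, hγ.monotone (Fin.zero_le j)]

theorem isS3_optimalSignature (hγ : StrictMono γ) {t : Fin n} (ht : 0 < t)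
    (h0 : ∃ i, optimalSignature γ p (knot γ (t, 1)) i 0 0 = true)
    (h1 : ∃ j, optimalSignature γ p (knot γ (t, 1)) j 0 1 = true) :
    IsS3 t (optimalSignature γ p (knot γ (t, 1))) := by
  refine ⟨ht, fun i hi => ?_, fun i hi => ?_, fun j => ?_, h0, h1⟩
  · have : excess γ (knot γ (t, 1)) i 1 ≤ 0 := by
      rw [excess_one, knot_one]; linarith [hγ.monotone hi]
    exact ⟨optimalSignature_of_nonpos this p 0, optimalSignature_of_nonpos this p 1⟩
  · exact optimalSignature_ne_of_pos (by rw [excess_one, knot_one]; linarith [hγ hi]) p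
  · refine optimalSignature_ne_of_pos ?_ p
    rw [excess_zero, knot_one]
    linarith [hγ ht, hγ.monotone (le_lastIdx j)]

theorem IsCapped.exists_shift_of_ge (hγ : Monotone γ) {α : ℝ} (hα : -γ 0 - γ (lastIdx n) ≤ α)
    {u : Fin n → Fin 2 → Fin 2 → ℝ} (hu : IsCapped γ α u)
    (h : (∀ i, u i 1 0 ≤ -γ (lastIdx n) - α) ∨ ∀ i, u i 1 1 ≤ -γ (lastIdx n)) :
    ∃ c, IsCapped γ (-γ 0 - γ (lastIdx n)) (shift c u) := by
  suffices ∃ c : ℝ, ∀ i d z, shift c u i d z ≤ cap γ (-γ 0 - γ (lastIdx n)) i d z from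
    this.imp fun c hc => ⟨hc, fun i d => (shift_add_shift c u i d).trans_le (hu.add_le_pairCap i d)⟩
  have h0 (i : Fin n) : γ 0 ≤ γ i := hγ (Fin.zero_le _)
  have hcap := fun i => le_cap_iff.1 (hu.le_cap i)
  simp only [le_cap_iff, shift_zero, shift_one]
  refine h.elim (fun h => ⟨α - (-γ 0 - γ (lastIdx n)), fun i => ?_⟩) fun h => ⟨0, fun i => ?_⟩
  all_goals refine ⟨⟨?_, ?_⟩, ?_, ?_⟩ <;> linarith [hcap i, h i, h0 i]

theorem IsCapped.exists_shift_of_le (hγ : Monotone γ) {α : ℝ} (hα : α ≤ -γ 0 - γ (lastIdx n))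
    {u : Fin n → Fin 2 → Fin 2 → ℝ} (hu : IsCapped γ α u)
    (h : (∀ i, u i 0 0 ≤ γ 0) ∨ ∀ i, u i 0 1 ≤ γ 0 + α) :
    ∃ c, IsCapped γ (-γ 0 - γ (lastIdx n)) (shift c u) := by
  suffices ∃ c : ℝ, ∀ i d z, shift c u i d z ≤ cap γ (-γ 0 - γ (lastIdx n)) i d z from
    this.imp fun c hc => ⟨hc, fun i d => (shift_add_shift c u i d).trans_le (hu.add_le_pairCap i d)⟩
  have h1 (i : Fin n) : γ i ≤ γ (lastIdx n) := hγ (le_lastIdx i)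
  have hcap := fun i => le_cap_iff.1 (hu.le_cap i)
  simp only [le_cap_iff, shift_zero, shift_one]
  refine h.elim (fun h => ⟨0, fun i => ?_⟩) fun h => ⟨α - (-γ 0 - γ (lastIdx n)), fun i => ?_⟩
  all_goals refine ⟨⟨?_, ?_⟩, ?_, ?_⟩ <;> linarith [hcap i, h i, h1 i]

theorem dualProfile_le_of_isCapped_shift (hp : (p, θ) ∈ responsePolytope γ) {α β c : ℝ}
    (h : IsCapped γ β (shift c (vertexMap γ α (optimalSignature γ p α)))) :
    dualProfile γ p α ≤ dualProfile γ p β := by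
  rw [← dot_vertexMap_optimalSignature,
    ← dot_shift c _ (by simp only [sum_eq_one_of_mem_responsePolytope hp])]
  exact h.dot_le_dualProfile (nonneg_of_mem_responsePolytope hp)

theorem dualProfile_midpoint_le_maxVertex (hγ : StrictMono γ) :
    dualProfile γ p (-γ 0 - γ (lastIdx n)) ≤ maxVertex γ p :=
  dualProfile_le_maxVertex_of_admissibleWith (.inr (.inl ⟨isS2_optimalSignature hγ p, rfl⟩))

theorem dualProfile_knot_zero_le_maxVertex (hγ : StrictMono γ) (hp : (p, θ) ∈ responsePolytope γ)
    (t : Fin n) : dualProfile γ p (knot γ (t, 0)) ≤ maxVertex γ p := by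
  rcases (le_lastIdx t).eq_or_lt with rfl | ht
  · exact dualProfile_midpoint_le_maxVertex hγ
  by_cases h : (∃ i, optimalSignature γ p (knot γ (t, 0)) i 1 0 = true) ∧
    ∃ j, optimalSignature γ p (knot γ (t, 0)) j 1 1 = true
  · exact dualProfile_le_maxVertex_of_admissibleWith
      (.inl ⟨t, isS1_optimalSignature hγ ht h.1 h.2, rfl⟩)
  · have capped := (isCompatible_optimalSignature γ p (knot γ (t, 0))).isCapped
    obtain ⟨c, hc⟩ := capped.exists_shift_of_ge hγ.monotone
      (by rw [knot_zero]; linarith [hγ ht]) <| (not_and_or.1 h).imp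
        (fun h i => by simp [vertexMap, not_exists.1 h i])
        fun h i => by simp [vertexMap, not_exists.1 h i]
    exact (dualProfile_le_of_isCapped_shift hp hc).trans (dualProfile_midpoint_le_maxVertex hγ)

theorem dualProfile_knot_one_le_maxVertex (hγ : StrictMono γ) (hp : (p, θ) ∈ responsePolytope γ)
    (t : Fin n) : dualProfile γ p (knot γ (t, 1)) ≤ maxVertex γ p := by
  rcases (Fin.zero_le t).eq_or_lt with rfl | ht
  · exact dualProfile_midpoint_le_maxVertex hγ
  by_cases h : (∃ i, optimalSignature γ p (knot γ (t, 1)) i 0 0 = true) ∧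
    ∃ j, optimalSignature γ p (knot γ (t, 1)) j 0 1 = true
  · exact dualProfile_le_maxVertex_of_admissibleWith
      (.inr (.inr ⟨t, isS3_optimalSignature hγ ht h.1 h.2, rfl⟩))
  · have capped := (isCompatible_optimalSignature γ p (knot γ (t, 1))).isCapped
    obtain ⟨c, hc⟩ := capped.exists_shift_of_le hγ.monotone
      (by rw [knot_one]; linarith [hγ ht]) <| (not_and_or.1 h).imp
        (fun h i => by simp [vertexMap, not_exists.1 h i])
        fun h i => by simp [vertexMap, not_exists.1 h i]
    exact (dualProfile_le_of_isCapped_shift hp hc).trans (dualProfile_midpoint_le_maxVertex hγ)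

theorem IsDualFeasible.dot_le_maxVertex (hγ : StrictMono γ) (hp : (p, θ) ∈ responsePolytope γ)
    {u : Fin n → Fin 2 → Fin 2 → ℝ} (hu : IsDualFeasible γ u) : dot u p ≤ maxVertex γ p := by
  obtain ⟨α, c, hc⟩ := hu.exists_isCapped_shift
  obtain ⟨⟨t, d⟩, ht⟩ := exists_dualProfile_le_knot hγ.monotone hp α
  calc dot u p = dot (shift c u) p :=
      (dot_shift c u (by simp only [sum_eq_one_of_mem_responsePolytope hp])).symm
    _ ≤ dualProfile γ p α := hc.dot_le_dualProfile (nonneg_of_mem_responsePolytope hp)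
    _ ≤ dualProfile γ p (knot γ (t, d)) := ht
    _ ≤ maxVertex γ p := by
      obtain rfl | rfl : d = 0 ∨ d = 1 := by omega
      · exact dualProfile_knot_zero_le_maxVertex hγ hp t
      · exact dualProfile_knot_one_le_maxVertex hγ hp t

theorem isLeast_maxVertex (hγ : StrictMono γ) (hp : (p, θ) ∈ responsePolytope γ) :
    IsLeast {θ | (p, θ) ∈ responsePolytope γ} (maxVertex γ p) := by
  have lower {s : ℝ} (hs : (p, s) ∈ responsePolytope γ) : maxVertex γ p ≤ s := by
    obtain ⟨_, ⟨B, α, hB, rfl⟩, h⟩ := (maxVertex_isGreatest γ p).1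
    exact h.symm.trans_le
      (((hB.isCompatible hγ.monotone).isCapped.isDualFeasible hγ.monotone).dot_le hs)
  exact ⟨mem_responsePolytope_of_forall_dot_le hp (lower hp) fun u hu => hu.dot_le_maxVertex hγ hp,
    fun s hs => lower hs⟩

end Profile

section Mixtures

variable {n : ℕ} {γ : Fin n → ℝ}

theorem exists_eq_sum_smul_mem_stdSimplex {ι : Type*} [Fintype ι] [Nonempty ι] {w : ι → ℝ}
    (hw : 0 ≤ w) : ∃ κ ∈ stdSimplex ℝ ι, w = (∑ i, w i) • κ := by
  classical
  obtain ⟨i₀⟩ := ‹Nonempty ι›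
  rcases (Finset.sum_nonneg fun i _ => hw i).eq_or_lt with h | h
  · refine ⟨_, single_mem_stdSimplex ℝ i₀, ?_⟩
    rw [← h, zero_smul]
    exact funext fun i => (Finset.sum_eq_zero_iff_of_nonneg fun i _ => hw i).1 h.symm i (by simp)
  · refine ⟨(∑ i, w i)⁻¹ • w, ⟨fun i => mul_nonneg (inv_nonneg.2 h.le) (hw i), ?_⟩, ?_⟩
    · simp only [Pi.smul_apply, smul_eq_mul, ← Finset.mul_sum, inv_mul_cancel₀ h.ne']
    · rw [smul_inv_smul₀ h.ne']

theorem mem_responsePolytope_of_mem_stdSimplex (γ : Fin n → ℝ) (x : Fin 2 → Fin n)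
    {κ : Fin 2 → Fin 2 → ℝ} (hκ : ∀ z, κ z ∈ stdSimplex ℝ (Fin 2)) :
    ((fun y d z => if x d = y then κ z d else 0), γ (x 1) - γ (x 0)) ∈ responsePolytope γ := by
  let K : Set (Fin 2 → Fin 2 → ℝ) :=
    {κ | ((fun y d z => if x d = y then κ z d else 0), γ (x 1) - γ (x 0)) ∈ responsePolytope γ}
  have convex_K : Convex ℝ K := fun κ hκ κ' hκ' a b ha hb hab => by
    change _ ∈ responsePolytope γ
    convert convex_responsePolytope γ hκ hκ' ha hb hab using 1
    refine Prod.ext ?_ (by simp [← add_mul, hab])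
    ext y d z
    by_cases h : x d = y
    · simp [h]
    · simp [h]
  have vertices_subset : Set.univ.pi (fun _ => Set.range fun e => Pi.single e 1) ⊆ K := by
    intro κ hκ
    choose d hd using fun z => hκ z (Set.mem_univ z)
    suffices h : (fun y e z => if x e = y then κ z e else 0) =
        ResponseType.condProb (x, d) from
      subset_convexHull ℝ _ ⟨(x, d), Prod.ext h.symm rfl⟩
    ext y e z
    simp [ResponseType.condProb, ← hd, Pi.single_apply, eq_comm (a := e), ← ite_and, and_comm]
  have : κ ∈ convexHull ℝ (Set.univ.pi fun _ => Set.range fun e => Pi.single e (1 : ℝ)) := by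
    rw [convexHull_pi]
    simpa [convexHull_rangle_single_eq_stdSimplex] using hκ
  exact convexHull_min vertices_subset convex_K this

theorem mem_responsePolytope_of_sum_eq {q : (Fin 2 → Fin n) → ℝ} (hq : ∑ x, q x = 1)
    {w : Fin 2 → (Fin 2 → Fin n) → Fin 2 → ℝ} (hw : 0 ≤ w) (hwq : ∀ z x, ∑ d, w z x d = q x) :
    ((fun y d z => ∑ x, if x d = y then w z x d else 0), ∑ x, q x * (γ (x 1) - γ (x 0))) ∈
      responsePolytope γ := by
  choose κ hκ hwκ using fun x z => exists_eq_sum_smul_mem_stdSimplex (hw z x)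
  simp only [hwq] at hwκ
  convert (convex_responsePolytope γ).sum_mem (t := .univ)
    (fun x _ => (Finset.sum_nonneg fun d _ => hw 0 x d).trans_eq (hwq 0 x)) hq
    fun x _ => mem_responsePolytope_of_mem_stdSimplex γ x (hκ x) using 1
  refine Prod.ext ?_ (by simp [Prod.snd_sum])
  ext y d z
  simp [Prod.fst_sum, Finset.sum_apply, hwκ _ z]

end Mixtures

theorem exists_measurable_comp_eq {Ω ι β : Type*} [MeasurableSpace Ω] [MeasurableSpace ι]
    [MeasurableSpace β] [MeasurableSingletonClass β] [Countable ι] {γ : ι → β} {f : Ω → β}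
    (hf : Measurable f) (hfγ : ∀ ω, f ω ∈ Set.range γ) :
    ∃ g : Ω → ι, Measurable g ∧ ∀ ω, γ (g ω) = f ω := by
  have := (Set.countable_range γ).to_subtype
  exact ⟨fun ω => Set.rangeSplitting γ ⟨f ω, hfγ ω⟩, (Measurable.of_discrete
    (f := Set.rangeSplitting γ)).comp (hf.subtype_mk), fun ω => Set.apply_rangeSplitting γ _⟩

theorem cond_apply_of_indepFun {Ω β β' : Type*} [MeasurableSpace Ω] [MeasurableSpace β]
    [MeasurableSpace β'] {μ : Measure Ω} [IsFiniteMeasure μ] {X : Ω → β} {Y : Ω → β'}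
    (hXY : IndepFun X Y μ) (hX : Measurable X) {s : Set β} {t : Set β'} (hs : MeasurableSet s)
    (ht : MeasurableSet t) (hμ : μ (X ⁻¹' s) ≠ 0) : μ[Y ⁻¹' t | X ⁻¹' s] = μ (Y ⁻¹' t) := by
  rw [cond_apply (hX hs), hXY.measure_inter_preimage_eq_mul _ _ hs ht, ← mul_assoc,
    ENNReal.inv_mul_cancel hμ (measure_ne_top μ _), one_mul]

namespace FullData

variable {n : ℕ} {γ : Fin n → ℝ} (M : FullData.{u} γ)

theorem measurable_obs : Measurable fun ω => (M.Y ω, M.D ω, M.Z ω) :=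
  M.measurable_Y.prodMk (M.measurable_D.prodMk M.measurable_Z)

theorem observedLaw_snd_snd (z : Fin 2) :
    M.observedLaw {w | w.2.2 = z} = M.μ (M.Z ⁻¹' {z}) :=
  Measure.map_apply M.measurable_obs (measurable_snd.snd (measurableSet_singleton z))

theorem condProbs_observedLaw (y : Fin n) (d z : Fin 2) :
    condProbs γ M.observedLaw y d z = (M.μ[|M.Z ⁻¹' {z}]).real {ω | M.Y ω = γ y ∧ M.D ω = d} := by
  have hz : MeasurableSet {w : ℝ × Fin 2 × Fin 2 | w.2.2 = z} :=
    measurable_snd.snd (measurableSet_singleton z)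
  have hyd : MeasurableSet {w : ℝ × Fin 2 × Fin 2 | w.1 = γ y ∧ w.2.1 = d} :=
    (measurable_fst (measurableSet_singleton (γ y))).inter
      (measurable_snd.fst (measurableSet_singleton d))
  simp only [condProbs, measureReal_def, cond_apply hz, observedLaw,
    cond_apply (M.measurable_Z (measurableSet_singleton z)),
    Measure.map_apply M.measurable_obs hz, Measure.map_apply M.measurable_obs (hz.inter hyd)]
  rfl

theorem exists_outcomeIndex : ∃ X : M.Ω → Fin 2 → Fin n, Measurable X ∧
    ∀ ω d, γ (X ω d) = M.potY d ω := by
  choose X hX hXγ using fun d => exists_measurable_comp_eq (M.measurable_pot d 0) (M.pot_mem d 0)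
  exact ⟨fun ω d => X d ω, measurable_pi_lambda _ hX, fun ω d => hXγ d ω⟩

variable {M}

theorem outcomeConsistency_iff :
    M.OutcomeConsistency ↔ ∀ᵐ ω ∂M.μ, M.Y ω = M.potY (M.D ω) ω := by
  refine Filter.eventually_congr (.of_forall fun ω => ?_)
  obtain h | h : M.D ω = 0 ∨ M.D ω = 1 := by omega
  all_goals simp [h]

theorem IsJointIV.measureReal_cond_outcomeIndex (hM : M.IsJointIV) (hγ : Function.Injective γ)
    {X : M.Ω → Fin 2 → Fin n} (hX : ∀ ω d, γ (X ω d) = M.potY d ω) {z : Fin 2}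
    (hz : M.μ (M.Z ⁻¹' {z}) ≠ 0) (x : Fin 2 → Fin n) :
    (M.μ[|M.Z ⁻¹' {z}]).real (X ⁻¹' {x}) = M.μ.real (X ⁻¹' {x}) := by
  have : X ⁻¹' {x} = (fun ω => (M.potY 0 ω, M.potY 1 ω)) ⁻¹' {(γ (x 0), γ (x 1))} := by
    ext ω
    simp [← hX, hγ.eq_iff, funext_iff]
  rw [this, measureReal_def, measureReal_def, cond_apply_of_indepFun hM.2.1 M.measurable_Z
    (measurableSet_singleton z) (measurableSet_singleton _) hz]

theorem IsJointIV.condProbs_observedLaw_eq_sum (hM : M.IsJointIV) (hγ : Function.Injective γ)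
    {X : M.Ω → Fin 2 → Fin n} (hX : Measurable X) (hXγ : ∀ ω d, γ (X ω d) = M.potY d ω)
    (y : Fin n) (d z : Fin 2) : condProbs γ M.observedLaw y d z =
      ∑ x, if x d = y then (M.μ[|M.Z ⁻¹' {z}]).real (X ⁻¹' {x} ∩ M.D ⁻¹' {d}) else 0 := by
  have consistency : {ω | M.Y ω = γ y ∧ M.D ω = d} =ᵐ[M.μ[|M.Z ⁻¹' {z}]]
      ((fun ω => X ω d) ⁻¹' {y} ∩ M.D ⁻¹' {d} : Set M.Ω) := by
    filter_upwards [cond_absolutelyContinuous.ae_le (outcomeConsistency_iff.1 hM.2.2)] with ω hω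
    refine propext (and_congr_left fun (hd : M.D ω = d) => ?_)
    rw [hω, hd, ← hXγ, hγ.eq_iff]
    rfl
  have := sum_measureReal_preimage_singleton (μ := (M.μ[|M.Z ⁻¹' {z}]).restrict (M.D ⁻¹' {d}))
    {x | x d = y} fun x _ => hX (measurableSet_singleton x)
  simp only [measureReal_restrict_apply (hX (.of_discrete))] at this
  rw [M.condProbs_observedLaw, measureReal_congr consistency, ← Finset.sum_filter, this]
  simp [Set.preimage]

theorem ate_eq_sum {X : M.Ω → Fin 2 → Fin n} (hX : Measurable X)
    (hXγ : ∀ ω d, γ (X ω d) = M.potY d ω) :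
    M.ate = ∑ x, M.μ.real (X ⁻¹' {x}) * (γ (x 1) - γ (x 0)) := by
  have : IsProbabilityMeasure (M.μ.map X) := Measure.isProbabilityMeasure_map hX.aemeasurable
  calc M.ate = ∫ x, γ (x 1) - γ (x 0) ∂M.μ.map X := by
        rw [integral_map hX.aemeasurable (by fun_prop)]
        simp only [ate, hXγ]
    _ = _ := by
      rw [integral_fintype .of_finite]
      simp [map_measureReal_apply hX]

theorem IsJointIV.mem_responsePolytope (hM : M.IsJointIV) (hγ : Function.Injective γ)
    (hZ : ∀ z, M.μ (M.Z ⁻¹' {z}) ≠ 0) :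
    (condProbs γ M.observedLaw, M.ate) ∈ responsePolytope γ := by
  obtain ⟨X, hX, hXγ⟩ := M.exists_outcomeIndex
  have sum_treatment (z : Fin 2) (x : Fin 2 → Fin n) :
      ∑ d, (M.μ[|M.Z ⁻¹' {z}]).real (X ⁻¹' {x} ∩ M.D ⁻¹' {d}) = M.μ.real (X ⁻¹' {x}) := by
    have := sum_measureReal_preimage_singleton (μ := (M.μ[|M.Z ⁻¹' {z}]).restrict (X ⁻¹' {x}))
      .univ fun d _ => M.measurable_D (measurableSet_singleton d)
    simpa [measureReal_restrict_apply (M.measurable_D (.of_discrete)), Set.inter_comm,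
      hM.measureReal_cond_outcomeIndex hγ hXγ (hZ z)] using this
  have sum_outcomes : ∑ x, M.μ.real (X ⁻¹' {x}) = 1 := by
    rw [sum_measureReal_preimage_singleton _ fun x _ => hX (measurableSet_singleton x)]
    simp
  convert mem_responsePolytope_of_sum_eq sum_outcomes (fun _ _ _ => measureReal_nonneg)
    sum_treatment using 2
  · ext y d z
    exact hM.condProbs_observedLaw_eq_sum hγ hX hXγ y d z
  · exact ate_eq_sum hX hXγ

end FullData

theorem convexHull_range_eq_image_stdSimplex {ι E : Type*} [Fintype ι] [AddCommGroup E]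
    [Module ℝ E] (v : ι → E) :
    convexHull ℝ (Set.range v) = Fintype.linearCombination ℝ v '' stdSimplex ℝ ι := by
  classical
  rw [← convexHull_rangle_single_eq_stdSimplex, LinearMap.image_convexHull, ← Set.range_comp]
  simp [Function.comp_def]

theorem exists_isProbabilityMeasure_real_singleton {ι : Type*} [Fintype ι] [MeasurableSpace ι]
    [MeasurableSingletonClass ι] {w : ι → ℝ} (hw : w ∈ stdSimplex ℝ ι) :
    ∃ ν : Measure ι, IsProbabilityMeasure ν ∧ ∀ i, ν.real {i} = w i := by
  have sum_eq_one : ∑ i, ENNReal.ofReal (w i) = 1 := by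
    rw [← ENNReal.ofReal_sum_of_nonneg fun i _ => hw.1 i, hw.2, ENNReal.ofReal_one]
  refine ⟨(PMF.ofFintype _ sum_eq_one).toMeasure, inferInstance, fun i => ?_⟩
  rw [measureReal_def, PMF.toMeasure_apply_singleton _ _ (measurableSet_singleton i),
    PMF.ofFintype_apply, ENNReal.toReal_ofReal (hw.1 i)]

section Realization

variable {n : ℕ} {γ : Fin n → ℝ}

theorem exists_measure_of_mem_responsePolytope {p : Fin n → Fin 2 → Fin 2 → ℝ} {θ : ℝ}
    (hp : (p, θ) ∈ responsePolytope γ) : ∃ ν : Measure (ResponseType n), IsProbabilityMeasure ν ∧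
      (∀ y d z, p y d z = ν.real {r | r.2 z = d ∧ r.1 d = y}) ∧ θ = ∫ r, r.effect γ ∂ν := by
  rw [responsePolytope, convexHull_range_eq_image_stdSimplex] at hp
  obtain ⟨w, hw, h⟩ := hp
  obtain ⟨ν, hν, hνw⟩ := exists_isProbabilityMeasure_real_singleton hw
  simp only [Fintype.linearCombination_apply, Prod.ext_iff, Prod.fst_sum, Prod.snd_sum] at h
  refine ⟨ν, hν, fun y d z => ?_, ?_⟩
  · have := sum_measureReal_singleton (μ := ν) {r | r.2 z = d ∧ r.1 d = y}
    rw [← h.1]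
    simp_all [ResponseType.condProb, Finset.sum_filter]
  · rw [← h.2, integral_fintype .of_finite]
    simp [hνw]

namespace FullData

/-- Every unit has a response type drawn from `ν`, and the instrument is drawn independently from
`ρ`. -/
noncomputable def ofResponseTypes (γ : Fin n → ℝ) (ν : Measure (ResponseType n))
    [IsProbabilityMeasure ν] (ρ : Measure (Fin 2)) [IsProbabilityMeasure ρ] : FullData.{0} γ where
  Ω := ResponseType n × Fin 2
  mΩ := inferInstance
  μ := ν.prod ρ
  isProb := inferInstance
  pot d _ ω := γ (ω.1.1 d)
  D ω := ω.1.2 ω.2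
  Z ω := ω.2
  Y ω := γ (ω.1.1 (ω.1.2 ω.2))
  measurable_pot _ _ := .of_discrete
  measurable_D := .of_discrete
  measurable_Z := .of_discrete
  measurable_Y := .of_discrete
  pot_mem _ _ _ := ⟨_, rfl⟩
  Y_mem _ := ⟨_, rfl⟩

variable (ν : Measure (ResponseType n)) [IsProbabilityMeasure ν] (ρ : Measure (Fin 2))
  [IsProbabilityMeasure ρ]

theorem isJointIV_ofResponseTypes : (ofResponseTypes γ ν ρ).IsJointIV :=
  ⟨fun _ _ _ => .rfl,
    (indepFun_prod (μ := ν) (ν := ρ) (X := fun r => (γ (r.1 0), γ (r.1 1))) .of_discrete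
      measurable_id).symm,
    outcomeConsistency_iff.2 (.of_forall fun _ => rfl)⟩

theorem ate_ofResponseTypes : (ofResponseTypes γ ν ρ).ate = ∫ r, r.effect γ ∂ν := by
  change ∫ ω, ResponseType.effect γ ω.1 ∂ν.prod ρ = _
  rw [integral_fun_fst, probReal_univ, one_smul]

theorem measureReal_ofResponseTypes_obs (hγ : Function.Injective γ) (y : Fin n) (d z : Fin 2) :
    (ofResponseTypes γ ν ρ).observedLaw.real {(γ y, d, z)} =
      ν.real {r | r.2 z = d ∧ r.1 d = y} * ρ.real {z} := by
  rw [observedLaw, map_measureReal_apply (measurable_obs _) (measurableSet_singleton _),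
    ← measureReal_prod_prod]
  change (ν.prod ρ).real _ = _
  congr 1
  ext ⟨r, z'⟩
  change (γ (r.1 (r.2 z')), r.2 z', z') = (γ y, d, z) ↔ (r.2 z = d ∧ r.1 d = y) ∧ z' = z
  simp only [Prod.mk.injEq, hγ.eq_iff]
  grind

theorem observedLaw_real_singleton (M : FullData.{u} γ) (y : Fin n) (d z : Fin 2) :
    M.observedLaw.real {(γ y, d, z)} =
      condProbs γ M.observedLaw y d z * M.μ.real (M.Z ⁻¹' {z}) := by
  rw [condProbs_observedLaw, measureReal_def, measureReal_def, measureReal_def,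
    ← ENNReal.toReal_mul, cond_mul_eq_inter (M.measurable_Z (measurableSet_singleton z)),
    observedLaw, Measure.map_apply M.measurable_obs (measurableSet_singleton _)]
  congr 2
  ext ω
  simp only [Set.mem_preimage, Set.mem_singleton_iff, Set.mem_inter_iff, Set.mem_ofPred_eq,
    Prod.mk.injEq]
  tauto

theorem exists_observedLaw_eq_map (M : FullData.{u} γ) :
    ∃ ν : Measure (Fin n × Fin 2 × Fin 2), IsFiniteMeasure ν ∧
      M.observedLaw = ν.map (Prod.map γ id) := by
  obtain ⟨g, hg, hgY⟩ := exists_measurable_comp_eq M.measurable_Y M.Y_mem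
  refine ⟨M.μ.map fun ω => (g ω, M.D ω, M.Z ω), inferInstance, ?_⟩
  rw [Measure.map_map .of_discrete (hg.prodMk (M.measurable_D.prodMk M.measurable_Z))]
  simp only [observedLaw, ← hgY]
  rfl

theorem observedLaw_ext (hγ : Function.Injective γ) {M : FullData.{u} γ} {M' : FullData.{v} γ}
    (h : ∀ y d z, M.observedLaw.real {(γ y, d, z)} = M'.observedLaw.real {(γ y, d, z)}) :
    M.observedLaw = M'.observedLaw := by
  obtain ⟨ν, _, hν⟩ := M.exists_observedLaw_eq_map
  obtain ⟨ν', _, hν'⟩ := M'.exists_observedLaw_eq_map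
  have preimage_singleton (w : Fin n × Fin 2 × Fin 2) :
      Prod.map γ id ⁻¹' {(γ w.1, w.2)} = {w} :=
    (hγ.prodMap Function.injective_id).preimage_image {w} ▸ by rw [Set.image_singleton]; rfl
  rw [hν, hν', Measure.ext_of_singleton (μ := ν) (ν := ν')]
  intro w
  have := h w.1 w.2.1 w.2.2
  rwa [hν, hν', map_measureReal_apply .of_discrete (measurableSet_singleton _),
    map_measureReal_apply .of_discrete (measurableSet_singleton _), preimage_singleton,
    measureReal_eq_measureReal_iff] at this

end FullData

theorem exists_isJointIV_of_mem_responsePolytope (hγ : Function.Injective γ) (M : FullData.{u} γ)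
    {θ : ℝ} (hθ : (condProbs γ M.observedLaw, θ) ∈ responsePolytope γ) :
    ∃ M' : FullData.{0} γ, M'.IsJointIV ∧ M'.observedLaw = M.observedLaw ∧ M'.ate = θ := by
  obtain ⟨ν, _, hp, rfl⟩ := exists_measure_of_mem_responsePolytope hθ
  have : IsProbabilityMeasure (M.μ.map M.Z) :=
    Measure.isProbabilityMeasure_map M.measurable_Z.aemeasurable
  refine ⟨.ofResponseTypes γ ν (M.μ.map M.Z), FullData.isJointIV_ofResponseTypes ν _,
    FullData.observedLaw_ext hγ fun y d z => ?_, FullData.ate_ofResponseTypes ν _⟩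
  rw [FullData.measureReal_ofResponseTypes_obs _ _ hγ, FullData.observedLaw_real_singleton, hp,
    map_measureReal_apply M.measurable_Z (measurableSet_singleton z)]

end Realization

theorem measurable_conj : Measurable fun w : ℝ × Fin 2 × Fin 2 => (w.1, 1 - w.2.1, w.2.2) := by
  fun_prop

theorem conjLaw_conjLaw (P : Measure (ℝ × Fin 2 × Fin 2)) : conjLaw (conjLaw P) = P := by
  rw [conjLaw, conjLaw, Measure.map_map measurable_conj measurable_conj]
  convert Measure.map_id
  ext1 w
  simp

namespace FullData

variable {n : ℕ} {γ : Fin n → ℝ} (M : FullData.{u} γ)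

/-- The model with the two treatment levels exchanged: its observed law is the conjugate law. -/
def conj : FullData.{u} γ where
  __ := M
  pot d z := M.pot (1 - d) z
  D ω := 1 - M.D ω
  measurable_pot d z := M.measurable_pot (1 - d) z
  measurable_D := Measurable.of_discrete.comp M.measurable_D
  pot_mem d z := M.pot_mem (1 - d) z

theorem observedLaw_conj : M.conj.observedLaw = conjLaw M.observedLaw :=
  (Measure.map_map measurable_conj M.measurable_obs).symm

theorem observedLaw_conj_snd_snd (z : Fin 2) :
    M.conj.observedLaw {w | w.2.2 = z} = M.observedLaw {w | w.2.2 = z} := by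
  rw [observedLaw_snd_snd, observedLaw_snd_snd]
  rfl

theorem ate_conj : M.conj.ate = -M.ate := by
  rw [ate, ate, ← integral_neg]
  exact integral_congr_ae (.of_forall fun ω => (neg_sub (M.potY 1 ω) (M.potY 0 ω)).symm)

variable {M}

theorem IsJointIV.conj (hM : M.IsJointIV) : M.conj.IsJointIV := by
  refine ⟨fun d => hM.1 (1 - d), hM.2.1.comp measurable_id measurable_swap,
    outcomeConsistency_iff.2 ?_⟩
  have := outcomeConsistency_iff.1 hM.2.2
  filter_upwards [this] with ω hω
  change M.Y ω = M.potY (1 - (1 - M.D ω)) ω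
  rw [sub_sub_cancel, hω]

variable [NeZero n]

theorem IsJointIV.lowerBound_le_ate (hM : M.IsJointIV) (hγ : StrictMono γ)
    (hZ : ∀ z, M.observedLaw {w | w.2.2 = z} ≠ 0) : lowerBound γ M.observedLaw ≤ M.ate := by
  have hp := hM.mem_responsePolytope hγ.injective fun z => M.observedLaw_snd_snd z ▸ hZ z
  exact (isLeast_maxVertex hγ hp).2 hp

theorem IsJointIV.exists_ate_eq_lowerBound (hM : M.IsJointIV) (hγ : StrictMono γ)
    (hZ : ∀ z, M.observedLaw {w | w.2.2 = z} ≠ 0) :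
    ∃ M' : FullData.{0} γ, M'.IsJointIV ∧ M'.observedLaw = M.observedLaw ∧
      M'.ate = lowerBound γ M.observedLaw :=
  exists_isJointIV_of_mem_responsePolytope hγ.injective M (isLeast_maxVertex hγ
    (hM.mem_responsePolytope hγ.injective fun z => M.observedLaw_snd_snd z ▸ hZ z)).1

theorem lowerBound_observedLaw_conj (M : FullData.{u} γ) :
    lowerBound γ M.conj.observedLaw = -upperBound γ M.observedLaw := by
  rw [observedLaw_conj, lowerBound, upperBound, neg_neg]

theorem IsJointIV.ate_le_upperBound (hM : M.IsJointIV) (hγ : StrictMono γ)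
    (hZ : ∀ z, M.observedLaw {w | w.2.2 = z} ≠ 0) : M.ate ≤ upperBound γ M.observedLaw := by
  rw [← neg_le_neg_iff, ← lowerBound_observedLaw_conj, ← ate_conj]
  exact hM.conj.lowerBound_le_ate hγ fun z => M.observedLaw_conj_snd_snd z ▸ hZ z

theorem IsJointIV.exists_ate_eq_upperBound (hM : M.IsJointIV) (hγ : StrictMono γ)
    (hZ : ∀ z, M.observedLaw {w | w.2.2 = z} ≠ 0) :
    ∃ M' : FullData.{0} γ, M'.IsJointIV ∧ M'.observedLaw = M.observedLaw ∧
      M'.ate = upperBound γ M.observedLaw := by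
  obtain ⟨M', hM', law_eq, ate_eq⟩ := hM.conj.exists_ate_eq_lowerBound hγ fun z =>
    M.observedLaw_conj_snd_snd z ▸ hZ z
  refine ⟨M'.conj, hM'.conj, ?_, ?_⟩
  · rw [observedLaw_conj, law_eq, observedLaw_conj, conjLaw_conjLaw]
  · rw [ate_conj, ate_eq, lowerBound_observedLaw_conj, neg_neg]

end FullData

end BinaryIV

theorem mainTheorem8 (n : ℕ) [NeZero n] (γ : Fin n → ℝ) (hγ : StrictMono γ)
    (P : Measure (ℝ × Fin 2 × Fin 2)) (hP : ∀ z : Fin 2, P {w | w.2.2 = z} ≠ 0) :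
    -- validity
    (∀ M : BinaryIV.FullData.{u} γ, M.IsJointIV → M.observedLaw = P →
      BinaryIV.lowerBound γ P ≤ M.ate ∧ M.ate ≤ BinaryIV.upperBound γ P) ∧
    -- sharpness
    ((∃ M : BinaryIV.FullData.{u} γ, M.IsJointIV ∧ M.observedLaw = P) →
      (∃ M : BinaryIV.FullData.{0} γ, M.IsJointIV ∧ M.observedLaw = P ∧
        M.ate = BinaryIV.lowerBound γ P) ∧
      (∃ M : BinaryIV.FullData.{0} γ, M.IsJointIV ∧ M.observedLaw = P ∧
        M.ate = BinaryIV.upperBound γ P)) := by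
  constructor
  · rintro M hM rfl
    exact ⟨hM.lowerBound_le_ate hγ hP, hM.ate_le_upperBound hγ hP⟩
  · rintro ⟨M, hM, rfl⟩
    exact ⟨hM.exists_ate_eq_lowerBound hγ hP, hM.exists_ate_eq_upperBound hγ hP⟩
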